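/- Let $\kappa>0$, $D_\kappa=\pi/\sqrt{\kappa}$, and let $X$ be a complete $\mathrm{CAT}(\kappa)$ space such that $d(w,w')<D_\kappa/2$ for all $w,w'\in X$. For $x,y\in X$ and $\alpha\in[0,1]$, let $\alpha x\oplus(1-\alpha)y$ denote the point $c((1-\alpha)d(x,y))$, where $c:[0,d(x,y)]\to X$ is the geodesic path from $x$ to $y$. Let $f:X\to(-\infty,\infty]$ be proper, lower semicontinuous and convex, that is, $f(\alpha x\oplus(1-\alpha)y)\le\alpha f(x)+(1-\alpha)f(y)$ for all $x,y\in X$ and $\alpha\in(0,1)$. Then for all $\eta>0$ and $x\in X$ the function $$y\mapsto f(y)+\frac1\eta\tan\bigl(\sqrt{\kappa}\,d(y,x)\bigr)\sin\bigl(\sqrt{\kappa}\,d(y,x)\bigr)$$ has a unique minimizer on $X$, denoted by $\tilde R_{\eta f}x$. Further, let $v\in X$, let $\{\alpha_n\}$ be a sequence in $(0,1]$ and $\{\lambda_n\}$ a sequence of positive real numbers such that $$\lim_{n\to\infty}\alpha_n=0,\qquad \sum_{n=1}^\infty\alpha_n^2=\infty,\qquad \inf_n\lambda_n>0,$$ and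 let $\{y_n\}$ be a sequence defined by $y_1\in X$ and $$y_{n+1}=\alpha_n v\oplus(1-\alpha_n)\tilde R_{\lambda_n f}y_n\qquad(n=1,2,\dots).$$ If the set $\operatorname{Argmin}_X f$ of minimizers of $f$ is nonempty, then the metric projection $P$ of $X$ onto $\operatorname{Argmin}_X f$ is well defined (every point of $X$ has a unique nearest point in $\operatorname{Argmin}_X f$), and both $\{y_n\}$ and $\{\tilde R_{\lambda_n f}y_n\}$ converge to $Pv$. -/

import Mathlib

noncomputable section

namespace CATSpace

/-- `c`, restricted to `[0, d x y]`, is a geodesic path from `x` to `y` with respect to the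
distance function `d`. The values of `c` outside `[0, d x y]` are irrelevant. -/
def IsGeodesicPath {X : Type*} (d : X → X → ℝ) (x y : X) (c : ℝ → X) : Prop :=
  c 0 = x ∧ c (d x y) = y ∧
    ∀ s ∈ Set.Icc 0 (d x y), ∀ t ∈ Set.Icc 0 (d x y), d (c s) (c t) = |s - t|

/-- The unit sphere of three dimensional Euclidean space. -/
abbrev S2 : Type := Metric.sphere (0 : EuclideanSpace ℝ (Fin 3)) 1

/-- The distance of the model surface of constant curvature `κ > 0`: the spherical (angular)
distance on the unit sphere divided by `√κ`. -/
def modelDist (κ : ℝ) (p q : S2) : ℝ :=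
  Real.arccos (inner ℝ (p : EuclideanSpace ℝ (Fin 3)) (q : EuclideanSpace ℝ (Fin 3))) / √κ

/-- The CAT(`κ`) condition, for `κ > 0`, with `D_κ = π / √κ`.
A geodesic triangle has vertices `x 0, x 1, x 2` and sides `c i` from `x i` to `x (i + 1)`,
a comparison triangle has vertices `x' 0, x' 1, x' 2` and sides `c' i`; the comparison point of
the point `c i s` is the point `c' i s` at the same distance `s` from the vertex. -/
structure IsCAT (κ : ℝ) (X : Type*) [MetricSpace X] : Prop where
  exists_geodesic : ∀ x y : X, dist x y < Real.pi / √κ → ∃ c : ℝ → X, IsGeodesicPath dist x y c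
  comparison : ∀ (x : Fin 3 → X) (c : Fin 3 → ℝ → X) (x' : Fin 3 → S2) (c' : Fin 3 → ℝ → S2),
    dist (x 0) (x 1) + dist (x 1) (x 2) + dist (x 2) (x 0) < 2 * (Real.pi / √κ) →
    (∀ i, IsGeodesicPath dist (x i) (x (i + 1)) (c i)) →
    (∀ i j, modelDist κ (x' i) (x' j) = dist (x i) (x j)) →
    (∀ i, IsGeodesicPath (modelDist κ) (x' i) (x' (i + 1)) (c' i)) →
    ∀ i j, ∀ s ∈ Set.Icc 0 (dist (x i) (x (i + 1))), ∀ t ∈ Set.Icc 0 (dist (x j) (x (j + 1))),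
      dist (c i s) (c j t) ≤ modelDist κ (c' i s) (c' j t)

variable {X : Type*} [MetricSpace X]

/-- `z` is the point `a x ⊕ (1 - a) y` on some geodesic path from `x` to `y`. -/
def IsConvexCombination (a : ℝ) (x y z : X) : Prop :=
  ∃ c : ℝ → X, IsGeodesicPath dist x y c ∧ z = c ((1 - a) * dist x y)

/-- A proper lower semicontinuous convex function of `X` into `(-∞, ∞]`. -/
structure IsProperLscConvex (f : X → EReal) : Prop where
  ne_bot : ∀ x, f x ≠ ⊥
  proper : ∃ x, f x ≠ ⊤
  lsc : LowerSemicontinuous f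
  convex : ∀ (x y z : X) (a : ℝ), 0 < a → a < 1 → IsConvexCombination a x y z →
    f z ≤ (a : EReal) * f x + ((1 - a : ℝ) : EReal) * f y

/-- The set of all minimizers of `g`. -/
def argmin {Y : Type*} (g : Y → EReal) : Set Y := {z | ∀ y, g z ≤ g y}

/-- The function of `y` minimized in the definition of the resolvent of `η f` at `x`. -/
def resolventObjective (κ η : ℝ) (f : X → EReal) (x y : X) : EReal :=
  f y + ((1 / η * (Real.tan (√κ * dist y x) * Real.sin (√κ * dist y x)) : ℝ) : EReal)

open Classical in
/-- The resolvent of `η f` at `x`: the minimizer of the objective (and `x` if there is none). -/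
def resolvent (κ η : ℝ) (f : X → EReal) (x : X) : X :=
  if h : (argmin (resolventObjective κ η f x)).Nonempty then h.choose else x

/-- `P` is the metric projection onto `C`: `P x` is the unique point of `C` nearest to `x`. -/
def IsMetricProjection (C : Set X) (P : X → X) : Prop :=
  ∀ x, P x ∈ C ∧ ∀ q ∈ C, q ≠ P x → dist x (P x) < dist x q

end CATSpace

end

/-! Measure distances after multiplication by `√κ`. Let p = Pv, z_n the resolvent of y_n, q = cos
d(v,p), c_n = cos d(z_n,p) and C_n = cos d(y_n,p). The goal is that 1 - C_n tends to 0; since C_n ≤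
c_n, this settles both sequences.

The CAT(κ) condition enters only through `IsConvexCombination.cos_dist_mul_sin_ge`. At midpoints it
makes the resolvent objective uniformly convex, so nested almost-minimizing sets shrink to a unique
minimizer (`existsUnique_mem_argmin`). Applied to the indicator function of the set of minimizers,
the same argument yields the projection.

First order optimality of the resolvent gives C_n ≤ cos d(z_n,y_n) c_n, and bounds λ_n (f(z_n) - min
f) by a constant times c_n - C_n (`resolvent_estimate`). The averaging with v gives C_{n+1} ≥ (1 -
b_n) c_n + b_n τ_n with α_n²/2 ≤ b_n ≤ α_n and τ_n = q(1 - α_n)/(cos d(v,z_n) + α_n)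
(`exists_halpern_weight`).

For large n there are two cases. If f(z_n) is close to min f, then z_n is not much closer to v than
p is (`exists_forall_cos_lt`), so τ_n is almost at least 1. Otherwise c_n - C_n exceeds a fixed θ >
0, which outweighs b_n. Either way 1 - C_{n+1} ≤ (1 - b_n)(1 - C_n) + b_n ε, and divergence of the
sum of α_n² finishes the proof (`eventually_le_of_le_mul_add`). No subsequences or weak limits are
needed. -/

namespace CATSpace

/-! ### Trigonometry of the model sphere -/

noncomputable section

/-- The spherical point with polar distance `e` from the first coordinate axis and with azimuth
of cosine `k`. -/
def spherePoint (e k : ℝ) (hk : k ^ 2 ≤ 1) : S2 :=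
  ⟨!₂[Real.cos e, Real.sin e * k, Real.sin e * √(1 - k ^ 2)], by
    have h : √(1 - k ^ 2) ^ 2 = 1 - k ^ 2 := Real.sq_sqrt (by linarith)
    rw [mem_sphere_zero_iff_norm, EuclideanSpace.norm_eq, Real.sqrt_eq_one]
    simp only [Fin.sum_univ_three, Real.norm_eq_abs, sq_abs]
    simp
    nlinarith [Real.sin_sq_add_cos_sq e]⟩

theorem inner_spherePoint (e k e' k' : ℝ) (hk : k ^ 2 ≤ 1) (hk' : k' ^ 2 ≤ 1) :
    inner ℝ (spherePoint e k hk : EuclideanSpace ℝ (Fin 3)) (spherePoint e' k' hk') =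
      Real.cos e * Real.cos e' + Real.sin e * Real.sin e' *
        (k * k' + √(1 - k ^ 2) * √(1 - k' ^ 2)) := by
  simp only [spherePoint, PiLp.inner_apply, Fin.sum_univ_three]
  simp
  ring

theorem inner_self_S2 (p : S2) :
    inner ℝ (p : EuclideanSpace ℝ (Fin 3)) (p : EuclideanSpace ℝ (Fin 3)) = 1 := by
  have h : ‖(p : EuclideanSpace ℝ (Fin 3))‖ = 1 := by simp
  rw [real_inner_self_eq_norm_sq, h, one_pow]

theorem modelDist_of_inner {κ L : ℝ} (hκ : 0 < κ) {p q : S2} (hL : 0 ≤ √κ * L)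
    (hL' : √κ * L ≤ Real.pi)
    (h : inner ℝ (p : EuclideanSpace ℝ (Fin 3)) (q : EuclideanSpace ℝ (Fin 3)) =
      Real.cos (√κ * L)) : modelDist κ p q = L := by
  have hs : 0 < √κ := Real.sqrt_pos.mpr hκ
  rw [modelDist, h, Real.arccos_cos hL hL']
  field_simp

theorem cos_modelDist {κ : ℝ} (hκ : 0 < κ) (p q : S2) :
    Real.cos (√κ * modelDist κ p q) =
      inner ℝ (p : EuclideanSpace ℝ (Fin 3)) (q : EuclideanSpace ℝ (Fin 3)) := by
  have hs : 0 < √κ := Real.sqrt_pos.mpr hκ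
  have hp : ‖(p : EuclideanSpace ℝ (Fin 3))‖ = 1 := by simp
  have hq : ‖(q : EuclideanSpace ℝ (Fin 3))‖ = 1 := by simp
  have h := abs_le.mp (abs_real_inner_le_norm (p : EuclideanSpace ℝ (Fin 3)) q)
  rw [hp, hq] at h
  rw [modelDist, mul_div_cancel₀ _ hs.ne', Real.cos_arccos (by linarith) (by linarith)]

theorem modelDist_comm (κ : ℝ) (p q : S2) : modelDist κ p q = modelDist κ q p := by
  rw [modelDist, modelDist, real_inner_comm]

/-- Existence of comparison triangles. -/
theorem exists_comparison_triangle {a b e : ℝ} (ha : 0 ≤ a) (ha' : a < Real.pi / 2)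
    (hb : 0 ≤ b) (hb' : b < Real.pi / 2) (he : 0 ≤ e) (he' : e < Real.pi / 2)
    (h1 : a ≤ b + e) (h2 : b ≤ a + e) (h3 : e ≤ a + b) :
    ∃ p q r : S2, inner ℝ (p : EuclideanSpace ℝ (Fin 3)) q = Real.cos a ∧
      inner ℝ (q : EuclideanSpace ℝ (Fin 3)) r = Real.cos b ∧
      inner ℝ (p : EuclideanSpace ℝ (Fin 3)) r = Real.cos e := by
  have hsa : 0 ≤ Real.sin a := Real.sin_nonneg_of_nonneg_of_le_pi ha (by linarith)
  have hse : 0 ≤ Real.sin e := Real.sin_nonneg_of_nonneg_of_le_pi he (by linarith)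
  have u1 : Real.cos (a + e) ≤ Real.cos b :=
    Real.cos_le_cos_of_nonneg_of_le_pi hb (by linarith) h2
  have u2 : Real.cos b ≤ Real.cos (a - e) := by
    rw [← Real.cos_abs (a - e)]
    refine Real.cos_le_cos_of_nonneg_of_le_pi (abs_nonneg _) (by linarith) ?_
    rw [abs_le]; constructor <;> linarith
  rw [Real.cos_add] at u1
  rw [Real.cos_sub] at u2
  -- By the spherical law of cosines, `k` is the cosine of the angle at `p`; the triangle
  -- inequalities say exactly that it lies in [-1, 1]. If a side at `p` has length zero, the angle
  -- is arbitrary.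
  obtain ⟨k, hk, hk'⟩ : ∃ k : ℝ, k ^ 2 ≤ 1 ∧
      Real.sin a * Real.sin e * k = Real.cos b - Real.cos a * Real.cos e := by
    rcases (mul_nonneg hsa hse).eq_or_lt with h0 | h0
    · exact ⟨0, by norm_num, by linarith⟩
    · refine ⟨(Real.cos b - Real.cos a * Real.cos e) / (Real.sin a * Real.sin e), ?_, ?_⟩
      · rw [sq_le_one_iff_abs_le_one, abs_div, abs_of_pos h0, div_le_one h0, abs_le]
        constructor <;> linarith
      · rw [mul_div_cancel₀ _ h0.ne']
  refine ⟨spherePoint 0 1 (by norm_num), spherePoint a 1 (by norm_num), spherePoint e k hk,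
    ?_, ?_, ?_⟩
  · rw [inner_spherePoint]; simp
  · rw [inner_spherePoint]; simp; linarith
  · rw [inner_spherePoint]; simp

/-- Geodesics of the model surface, with the inner products of their points. -/
theorem exists_modelGeodesic {κ : ℝ} (hκ : 0 < κ) (p q : S2) {L : ℝ} (hL : 0 ≤ √κ * L)
    (hL' : √κ * L < Real.pi)
    (h : inner ℝ (p : EuclideanSpace ℝ (Fin 3)) (q : EuclideanSpace ℝ (Fin 3)) =
      Real.cos (√κ * L)) :
    ∃ c : ℝ → S2, IsGeodesicPath (modelDist κ) p q c ∧ ∀ (r : S2) (t : ℝ),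
      inner ℝ (c t : EuclideanSpace ℝ (Fin 3)) (r : EuclideanSpace ℝ (Fin 3)) *
          Real.sin (√κ * L) =
        Real.sin (√κ * L - √κ * t) * inner ℝ (p : EuclideanSpace ℝ (Fin 3)) r +
          Real.sin (√κ * t) * inner ℝ (q : EuclideanSpace ℝ (Fin 3)) r := by
  have hs : 0 < √κ := Real.sqrt_pos.mpr hκ
  have hd : modelDist κ p q = L := modelDist_of_inner hκ hL hL'.le h
  have hp : ‖(p : EuclideanSpace ℝ (Fin 3))‖ = 1 := by simp
  have hq : ‖(q : EuclideanSpace ℝ (Fin 3))‖ = 1 := by simp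
  rcases hL.eq_or_lt with h0 | h0
  · have hL0 : L = 0 := by
      rcases mul_eq_zero.mp h0.symm with h | h
      · exact absurd h hs.ne'
      · exact h
    subst hL0
    have hpq : p = q := by
      apply Subtype.ext
      rw [mul_zero, Real.cos_zero] at h
      exact (inner_eq_one_iff_of_norm_eq_one hp hq).mp h
    subst hpq
    refine ⟨fun _ => p, ⟨rfl, rfl, ?_⟩, ?_⟩
    · intro s hs' t ht'
      rw [hd] at hs' ht' ⊢
      have h1 := le_antisymm hs'.2 hs'.1
      have h2 := le_antisymm ht'.2 ht'.1
      simp [h1, h2]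
    · intro r t
      simp
  · have hsin : 0 < Real.sin (√κ * L) := Real.sin_pos_of_pos_of_lt_pi h0 hL'
    -- The unit tangent vector at `p` pointing towards `q`; the geodesic is the great circle arc cos
    -- · p + sin · n.
    set n : EuclideanSpace ℝ (Fin 3) :=
      (Real.sin (√κ * L))⁻¹ • ((q : EuclideanSpace ℝ (Fin 3)) - Real.cos (√κ * L) • p.1) with hn
    have hpp := inner_self_S2 p
    have hqq := inner_self_S2 q
    have hqp : inner ℝ (q : EuclideanSpace ℝ (Fin 3)) (p : EuclideanSpace ℝ (Fin 3)) =
        Real.cos (√κ * L) := by rw [real_inner_comm, h]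
    have hpn : inner ℝ (p : EuclideanSpace ℝ (Fin 3)) n = 0 := by
      rw [hn, inner_smul_right, inner_sub_right, inner_smul_right, h, hpp]; ring
    have hnp : inner ℝ n (p : EuclideanSpace ℝ (Fin 3)) = 0 := by rw [real_inner_comm, hpn]
    have hnn : inner ℝ n n = 1 := by
      rw [hn, inner_smul_right, inner_smul_left, inner_sub_left, inner_sub_right, inner_sub_right,
        inner_smul_right, inner_smul_left, inner_smul_left, inner_smul_right, h, hqp, hpp, hqq]
      simp only [conj_trivial]
      have := Real.sin_sq_add_cos_sq (√κ * L)
      field_simp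
      nlinarith
    have hin : ∀ s t : ℝ, inner ℝ (Real.cos s • (p : EuclideanSpace ℝ (Fin 3)) + Real.sin s • n)
        (Real.cos t • (p : EuclideanSpace ℝ (Fin 3)) + Real.sin t • n) = Real.cos (s - t) := by
      intro s t
      simp only [inner_add_left, inner_add_right, inner_smul_left, inner_smul_right, hpn, hnp, hnn,
        hpp, conj_trivial, Real.cos_sub]
      ring
    have hmem : ∀ s : ℝ, Real.cos s • (p : EuclideanSpace ℝ (Fin 3)) + Real.sin s • n ∈
        Metric.sphere (0 : EuclideanSpace ℝ (Fin 3)) 1 := by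
      intro s
      rw [mem_sphere_zero_iff_norm, ← sq_eq_sq₀ (norm_nonneg _) zero_le_one,
        ← real_inner_self_eq_norm_sq, hin]
      simp
    refine ⟨fun t => ⟨_, hmem (√κ * t)⟩, ⟨?_, ?_, ?_⟩, ?_⟩
    · apply Subtype.ext
      simp
    · apply Subtype.ext
      simp only [hd, hn]
      rw [smul_smul, mul_inv_cancel₀ hsin.ne', one_smul]
      abel
    · intro s hs' t ht'
      rw [hd] at hs' ht'
      have habs : |s - t| ≤ L := by
        rw [abs_le]; constructor <;> linarith [hs'.1, hs'.2, ht'.1, ht'.2]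
      refine modelDist_of_inner hκ (by positivity) ?_ ?_
      · nlinarith [mul_le_mul_of_nonneg_left habs hs.le]
      · rw [hin, ← Real.cos_abs, ← mul_sub, abs_mul, abs_of_pos hs]
    · intro r t
      simp only [hn, inner_add_left, inner_smul_left, inner_sub_left, conj_trivial, Real.sin_sub]
      field_simp
      ring

/-! ### The CAT(κ) inequality in trigonometric form -/

section

variable {X : Type*} [MetricSpace X] {κ : ℝ}

theorem sqrt_mul_dist_lt (hκ : 0 < κ) (hdist : ∀ w w' : X, dist w w' < Real.pi / √κ / 2)
    (x y : X) : √κ * dist x y < Real.pi / 2 := by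
  have hs : 0 < √κ := Real.sqrt_pos.mpr hκ
  calc √κ * dist x y < √κ * (Real.pi / √κ / 2) := mul_lt_mul_of_pos_left (hdist x y) hs
    _ = Real.pi / 2 := by field_simp

theorem exists_isConvexCombination (hκ : 0 < κ) (hX : IsCAT κ X)
    (hdist : ∀ w w' : X, dist w w' < Real.pi / √κ / 2) (a : ℝ) (x y : X) :
    ∃ z, IsConvexCombination a x y z := by
  have hs : 0 < √κ := Real.sqrt_pos.mpr hκ
  have : 0 < Real.pi / √κ := by positivity
  obtain ⟨c, hc⟩ := hX.exists_geodesic x y (by linarith [hdist x y])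
  exact ⟨_, c, hc, rfl⟩

theorem IsConvexCombination.dist_left {a : ℝ} (ha : 0 ≤ a) (ha' : a ≤ 1) {x y z : X}
    (h : IsConvexCombination a x y z) : dist x z = (1 - a) * dist x y := by
  obtain ⟨c, ⟨h0, -, hc⟩, rfl⟩ := h
  have h1 : 0 ≤ (1 - a) * dist x y := mul_nonneg (by linarith) dist_nonneg
  have := hc 0 ⟨le_rfl, dist_nonneg⟩ ((1 - a) * dist x y)
    ⟨h1, by nlinarith [dist_nonneg (x := x) (y := y)]⟩
  rw [h0, zero_sub, abs_neg, abs_of_nonneg h1] at this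
  exact this

/-- The CAT(`κ`) inequality for a point of a geodesic and a third point, in trigonometric form. -/
theorem IsConvexCombination.cos_dist_mul_sin_ge (hκ : 0 < κ) (hX : IsCAT κ X)
    (hdist : ∀ w w' : X, dist w w' < Real.pi / √κ / 2) {a : ℝ} (ha : 0 ≤ a) (ha' : a ≤ 1)
    {x y z : X} (h : IsConvexCombination a x y z) (p : X) :
    Real.cos (√κ * dist x p) * Real.sin (a * (√κ * dist x y)) +
        Real.cos (√κ * dist y p) * Real.sin ((1 - a) * (√κ * dist x y)) ≤
      Real.cos (√κ * dist z p) * Real.sin (√κ * dist x y) := by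
  have hs : 0 < √κ := Real.sqrt_pos.mpr hκ
  have hlt := sqrt_mul_dist_lt hκ hdist
  have hpos : ∀ x y : X, 0 ≤ √κ * dist x y := fun x y => by positivity
  have hpi := Real.pi_pos
  have hDpos : 0 < Real.pi / √κ := by positivity
  obtain ⟨c, hc, rfl⟩ := h
  obtain ⟨c1, hc1⟩ := hX.exists_geodesic y p (by linarith [hdist y p])
  obtain ⟨c2, hc2⟩ := hX.exists_geodesic p x (by linarith [hdist p x])
  obtain ⟨p', q', r', e1, e2, e3⟩ := exists_comparison_triangle (hpos x y) (hlt x y)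
    (hpos y p) (hlt y p) (hpos x p) (hlt x p)
    (by rw [← mul_add]
        exact mul_le_mul_of_nonneg_left (by linarith [dist_triangle_right x y p]) hs.le)
    (by rw [← mul_add]
        exact mul_le_mul_of_nonneg_left (by linarith [dist_triangle y x p, dist_comm x y]) hs.le)
    (by rw [← mul_add]; exact mul_le_mul_of_nonneg_left (dist_triangle x y p) hs.le)
  have e3' : inner ℝ (r' : EuclideanSpace ℝ (Fin 3)) (p' : EuclideanSpace ℝ (Fin 3)) =
      Real.cos (√κ * dist p x) := by rw [real_inner_comm, e3, dist_comm]
  obtain ⟨g0, hg0, hg0'⟩ := exists_modelGeodesic hκ p' q' (hpos x y) (by linarith [hlt x y]) e1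
  obtain ⟨g1, hg1, -⟩ := exists_modelGeodesic hκ q' r' (hpos y p) (by linarith [hlt y p]) e2
  obtain ⟨g2, hg2, -⟩ := exists_modelGeodesic hκ r' p' (hpos p x) (by linarith [hlt p x]) e3'
  have hself : ∀ p : S2, modelDist κ p p = 0 := fun p =>
    modelDist_of_inner hκ (by simp) (by simpa using hpi.le) (by simp)
  have d01 : modelDist κ p' q' = dist x y :=
    modelDist_of_inner hκ (hpos x y) (by linarith [hlt x y]) e1
  have d12 : modelDist κ q' r' = dist y p :=
    modelDist_of_inner hκ (hpos y p) (by linarith [hlt y p]) e2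
  have d02 : modelDist κ p' r' = dist x p :=
    modelDist_of_inner hκ (hpos x p) (by linarith [hlt x p]) e3
  have hmem : (1 - a) * dist x y ∈ Set.Icc 0 (dist x y) :=
    ⟨mul_nonneg (by linarith) dist_nonneg, by nlinarith [dist_nonneg (x := x) (y := y)]⟩
  -- Side 0 runs from `x` to `y`, and side 2 starts at `p`, so parameter 0 on side 2 compares `z`
  -- with the vertex `p`.
  have key := hX.comparison ![x, y, p] ![c, c1, c2] ![p', q', r'] ![g0, g1, g2]
    (by simp; linarith [hdist x y, hdist y p, hdist p x])
    (by intro i; fin_cases i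
        · exact hc
        · exact hc1
        · exact hc2)
    (by intro i j
        fin_cases i <;> fin_cases j <;>
          simp [hself, d01, d12, d02, modelDist_comm κ q' p', modelDist_comm κ r' q',
            modelDist_comm κ r' p', dist_comm y x, dist_comm p y, dist_comm p x])
    (by intro i; fin_cases i
        · exact hg0
        · exact hg1
        · exact hg2)
    0 2 ((1 - a) * dist x y) hmem 0 ⟨le_rfl, dist_nonneg⟩
  have key' : dist (c ((1 - a) * dist x y)) p ≤ modelDist κ (g0 ((1 - a) * dist x y)) r' := by
    have h1 : dist (c ((1 - a) * dist x y)) (c2 0) ≤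
      modelDist κ (g0 ((1 - a) * dist x y)) (g2 0) := key
    rwa [hc2.1, hg2.1] at h1
  set z := c ((1 - a) * dist x y)
  set z' := g0 ((1 - a) * dist x y) with hz'
  have hcos : inner ℝ (z' : EuclideanSpace ℝ (Fin 3)) (r' : EuclideanSpace ℝ (Fin 3)) ≤
      Real.cos (√κ * dist z p) := by
    rw [← cos_modelDist hκ]
    refine Real.cos_le_cos_of_nonneg_of_le_pi (hpos _ _) ?_
      (mul_le_mul_of_nonneg_left key' hs.le)
    rw [modelDist, mul_div_cancel₀ _ hs.ne']
    exact Real.arccos_le_pi _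
  have hf := hg0' r' ((1 - a) * dist x y)
  rw [← hz', e3, e2] at hf
  have hsin : 0 ≤ Real.sin (√κ * dist x y) :=
    Real.sin_nonneg_of_nonneg_of_le_pi (hpos x y) (by linarith [hlt x y])
  have h2 := mul_le_mul_of_nonneg_right hcos hsin
  rw [hf] at h2
  have r1 : √κ * dist x y - √κ * ((1 - a) * dist x y) = a * (√κ * dist x y) := by ring
  have r2 : √κ * ((1 - a) * dist x y) = (1 - a) * (√κ * dist x y) := by ring
  rw [r1, r2] at h2
  linarith

end

end

/-! ### Real inequalities and the recursion -/

section RealInequalities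

/-- Source of the uniform convexity of the resolvent penalty 1/cos - cos. With b the mean of `c₁`
and `c₂`, C ≥ b/k and 1/C - C is decreasing. Then 1/k ≥ 2 - k and 1/b + b ≥ 2 extract the gain 2(1 -
k), and convexity of 1/t returns from b to `c₁`, `c₂`. -/
theorem one_div_sub_le_of_add_le {c₁ c₂ C k : ℝ} (h₁ : 0 < c₁) (h₂ : 0 < c₂) (hC : 0 < C)
    (hk : 0 < k) (hk' : k ≤ 1) (h : c₁ + c₂ ≤ 2 * k * C) :
    1 / C - C ≤ (1 / c₁ - c₁ + (1 / c₂ - c₂)) / 2 - 2 * (1 - k) := by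
  set b := (c₁ + c₂) / 2 with hb
  have hb0 : 0 < b := by positivity
  have e1 : 1 / C ≤ k / b := by
    rw [div_le_div_iff₀ hC hb0]; linarith
  have e2 : b / k ≤ C := by
    rw [div_le_iff₀ hk]; linarith
  have e3 : b + b * (1 - k) ≤ b / k := by
    rw [le_div_iff₀ hk]
    nlinarith [mul_nonneg hb0.le (sq_nonneg (1 - k))]
  have e4 : k / b = 1 / b - (1 - k) * (1 / b) := by ring
  have e5 : 2 ≤ 1 / b + b := by
    have : 1 / b + b - 2 = (1 - b) ^ 2 / b := by field_simp; ring
    have : 0 ≤ (1 - b) ^ 2 / b := by positivity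
    linarith
  have e6 : 1 / b ≤ (1 / c₁ + 1 / c₂) / 2 := by
    have : (1 / c₁ + 1 / c₂) / 2 - 1 / b = (c₁ - c₂) ^ 2 / (2 * c₁ * c₂ * (c₁ + c₂)) := by
      rw [hb]; field_simp; ring
    have : 0 ≤ (c₁ - c₂) ^ 2 / (2 * c₁ * c₂ * (c₁ + c₂)) := by positivity
    linarith
  have e7 := mul_le_mul_of_nonneg_left e5 (sub_nonneg.mpr hk')
  nlinarith

theorem mul_sin_le_sin_mul {a D : ℝ} (ha : 0 ≤ a) (ha' : a ≤ 1) (hD : 0 ≤ D)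
    (hD' : D ≤ Real.pi) : a * Real.sin D ≤ Real.sin (a * D) := by
  have := strictConcaveOn_sin_Icc.concaveOn.2 (x := D) ⟨hD, hD'⟩ (y := 0) ⟨le_rfl, Real.pi_pos.le⟩
    ha (sub_nonneg.mpr ha') (by ring)
  simpa using this

theorem cos_le_cos_add_sub {x y : ℝ} (h : x ≤ y) : Real.cos x ≤ Real.cos y + (y - x) := by
  have h1 := (abs_le.mp (Real.abs_cos_sub_cos_le x y)).2
  rw [abs_of_nonpos (sub_nonpos.mpr h)] at h1
  linarith

theorem two_div_pi_sq_mul_sq_le_one_sub_cos {x : ℝ} (hx : 0 ≤ x) (hx' : x ≤ Real.pi) :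
    2 / Real.pi ^ 2 * x ^ 2 ≤ 1 - Real.cos x := by
  have h := Real.mul_le_sin (x := x / 2) (by linarith) (by linarith)
  have h2 : Real.cos x = 1 - 2 * Real.sin (x / 2) ^ 2 := by
    have := Real.cos_two_mul (x / 2)
    have h3 := Real.sin_sq_add_cos_sq (x / 2)
    rw [mul_div_cancel₀ _ two_ne_zero] at this
    linarith
  have h0 : 0 ≤ 2 / Real.pi * (x / 2) := by positivity
  have h4 := pow_le_pow_left₀ h0 h 2
  have h5 : 2 / Real.pi ^ 2 * x ^ 2 = 2 * (2 / Real.pi * (x / 2)) ^ 2 := by field_simp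
  rw [h2, h5]; linarith

theorem nonneg_of_hasDerivAt_of_le {h : ℝ → ℝ} {h' : ℝ} (hd : HasDerivAt h h' 0)
    (hle : ∀ t, 0 < t → t < 1 → h 0 ≤ h t) : 0 ≤ h' := by
  have ht := hd.tendsto_slope_zero_right
  refine ge_of_tendsto ht ?_
  filter_upwards [Ioo_mem_nhdsGT (zero_lt_one' ℝ)] with t h1
  have h2 := hle t h1.1 h1.2
  rw [zero_add, smul_eq_mul]
  exact mul_nonneg (inv_nonneg.mpr h1.1.le) (by linarith)

/-- One step of a Halpern iteration, for a geodesic of angular length `D`. -/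
theorem exists_halpern_weight {a D q c C : ℝ} (ha : 0 < a) (ha' : a ≤ 1) (hD : 0 ≤ D)
    (hD' : D < Real.pi / 2) (hq : 0 ≤ q) (h0 : D = 0 → C = q ∧ c = q)
    (hC : q * Real.sin (a * D) + c * Real.sin ((1 - a) * D) ≤ C * Real.sin D) :
    ∃ b, a ^ 2 / 2 ≤ b ∧ b ≤ a ∧ (1 - b) * c + b * (q * (1 - a) / (Real.cos D + a)) ≤ C := by
  have hpi := Real.pi_pos
  have hpi4 := Real.pi_le_four
  have hcosD : 0 < Real.cos D := Real.cos_pos_of_mem_Ioo ⟨by linarith, hD'⟩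
  rcases hD.eq_or_lt with h | hpos
  -- For D = 0 the inequality `hC` reads 0 ≤ 0, so the information comes from `h0`.
  · obtain ⟨rfl, rfl⟩ := h0 h.symm
    refine ⟨a, by nlinarith, le_rfl, ?_⟩
    have : c * (1 - a) / (Real.cos D + a) ≤ c := by
      rw [← h, Real.cos_zero, div_le_iff₀ (by linarith)]
      nlinarith
    nlinarith
  · have hsin : 0 < Real.sin D := Real.sin_pos_of_pos_of_lt_pi hpos (by linarith)
    have hsinh : 0 < Real.sin (D / 2) := Real.sin_pos_of_pos_of_lt_pi (by linarith) (by linarith)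
    have haD : a * D ≤ D := by nlinarith
    have haD0 : 0 < a * D := mul_pos ha hpos
    have hsum : Real.sin D - Real.sin ((1 - a) * D) =
        2 * Real.sin (a * D / 2) * Real.cos ((1 - a / 2) * D) := by
      rw [Real.sin_sub_sin]; congr 3 <;> ring
    have hA : 0 < Real.sin (a * D / 2) :=
      Real.sin_pos_of_pos_of_lt_pi (by linarith) (by linarith)
    have hb : (Real.sin D - Real.sin ((1 - a) * D)) / Real.sin D * Real.sin D =
      Real.sin D - Real.sin ((1 - a) * D) := div_mul_cancel₀ _ hsin.ne'
    -- That is, 1 - b = sin((1 - a)D)/sin D, the exact coefficient of `c` in `hC`.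
    set b := (Real.sin D - Real.sin ((1 - a) * D)) / Real.sin D with hbdef
    have h1 : a * Real.sin (D / 2) ≤ Real.sin (a * D / 2) := by
      have := mul_sin_le_sin_mul ha.le ha' (by linarith : 0 ≤ D / 2) (by linarith)
      rwa [← mul_div_assoc] at this
    -- Since D < π/2, the cosine is at least sin(aπ/4), and Jordan's inequality applies. As D
    -- approaches π/2 this factor is itself of order a, whence the quadratic lower bound on b.
    have h2 : a / 2 ≤ Real.cos ((1 - a / 2) * D) := by
      have e1 : Real.cos (Real.pi / 2 - a * (Real.pi / 4)) ≤ Real.cos ((1 - a / 2) * D) := by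
        refine Real.cos_le_cos_of_nonneg_of_le_pi (by nlinarith) (by nlinarith) ?_
        nlinarith
      rw [Real.cos_pi_div_two_sub] at e1
      have e2 := Real.mul_le_sin (x := a * (Real.pi / 4)) (by positivity) (by nlinarith)
      have e3 : 2 / Real.pi * (a * (Real.pi / 4)) = a / 2 := by field_simp; ring
      linarith
    have h3 : Real.sin D ≤ 2 * Real.sin (D / 2) := by
      have := Real.sin_two_mul (D / 2)
      rw [mul_div_cancel₀ _ two_ne_zero] at this
      rw [this]
      nlinarith [Real.cos_le_one (D / 2)]
    have h4 : 1 - a ≤ Real.cos (a * D / 2) := by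
      have := Real.one_sub_sq_div_two_le_cos (x := a * D / 2)
      have hx : a * D / 2 ≤ a := by nlinarith
      nlinarith
    have h5 : Real.cos ((1 - a / 2) * D) ≤ Real.cos D + a := by
      have := cos_le_cos_add_sub (x := (1 - a / 2) * D) (y := D) (by nlinarith)
      nlinarith
    have h6 : (1 - a) * Real.sin D ≤ Real.sin ((1 - a) * D) :=
      mul_sin_le_sin_mul (by linarith) (by linarith) hD (by linarith)
    refine ⟨b, ?_, ?_, ?_⟩
    · rw [hbdef, le_div_iff₀ hsin, hsum]
      have := mul_le_mul h1 h2 (by positivity) hA.le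
      nlinarith [mul_le_mul_of_nonneg_left h3 (sq_nonneg a)]
    · rw [hbdef, div_le_iff₀ hsin]; linarith
    · have h7 : (1 - a) * (Real.sin D - Real.sin ((1 - a) * D)) ≤
          Real.sin (a * D) * (Real.cos D + a) := by
        have e := Real.sin_two_mul (a * D / 2)
        rw [mul_div_cancel₀ _ two_ne_zero] at e
        rw [hsum, e]
        have := mul_le_mul h4 h5 (by linarith) (by linarith)
        nlinarith
      have hden : 0 < Real.cos D + a := by linarith
      have h8 : b * (q * (1 - a) / (Real.cos D + a)) * Real.sin D ≤ q * Real.sin (a * D) := by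
        have : b * (q * (1 - a) / (Real.cos D + a)) * Real.sin D =
            q * ((1 - a) * (b * Real.sin D)) / (Real.cos D + a) := by ring
        rw [this, hb, div_le_iff₀ hden, mul_assoc]
        exact mul_le_mul_of_nonneg_left h7 hq
      refine le_of_mul_le_mul_right ?_ hsin
      have h9 : (1 - b) * c * Real.sin D = c * Real.sin ((1 - a) * D) := by
        have : (1 - b) * c * Real.sin D = c * (Real.sin D - b * Real.sin D) := by ring
        rw [this, hb]; ring
      rw [add_mul, h9]
      linarith

/-- The excess s - ε is multiplied by at most 1 - b ≤ exp(-a) at each step, so it is dominated by a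
constant times exp of minus a divergent sum. -/
theorem eventually_le_of_le_mul_add {s b a : ℕ → ℝ} {ε : ℝ} (hε : 0 < ε)
    (hb1 : ∀ n, b n ≤ 1) (hab : ∀ n, a n ≤ b n)
    (ha : Filter.Tendsto (fun N => ∑ n ∈ Finset.range N, a n) Filter.atTop Filter.atTop)
    (h : ∀ᶠ n in Filter.atTop, s (n + 1) ≤ (1 - b n) * s n + b n * ε) :
    ∀ᶠ n in Filter.atTop, s n ≤ 2 * ε := by
  obtain ⟨N, hN⟩ := Filter.eventually_atTop.mp h
  have hind : ∀ k, s (N + k) - ε ≤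
      |s N - ε| * Real.exp (-(∑ n ∈ Finset.range (N + k), a n - ∑ n ∈ Finset.range N, a n)) := by
    intro k
    induction k with
    | zero => simpa using le_abs_self (s N - ε)
    | succ k ih =>
      have h1 := hN (N + k) (by omega)
      have h2 : 1 - b (N + k) ≤ Real.exp (-(a (N + k))) := by
        have := Real.add_one_le_exp (-(a (N + k)))
        linarith [hab (N + k)]
      rw [← add_assoc, Finset.sum_range_succ]
      set E := |s N - ε| *
        Real.exp (-(∑ n ∈ Finset.range (N + k), a n - ∑ n ∈ Finset.range N, a n)) with hE
      have hE0 : 0 ≤ E := by positivity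
      have h3 : |s N - ε| * Real.exp (-(∑ n ∈ Finset.range (N + k), a n + a (N + k) -
          ∑ n ∈ Finset.range N, a n)) = E * Real.exp (-(a (N + k))) := by
        rw [hE, mul_assoc, ← Real.exp_add]; congr 2; ring
      rw [h3]
      calc s (N + k + 1) - ε ≤ (1 - b (N + k)) * (s (N + k) - ε) := by linarith
        _ ≤ (1 - b (N + k)) * E := mul_le_mul_of_nonneg_left ih (by linarith [hb1 (N + k)])
        _ ≤ E * Real.exp (-(a (N + k))) := by
          rw [mul_comm]; exact mul_le_mul_of_nonneg_left h2 hE0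
  have hlim : Filter.Tendsto (fun m => |s N - ε| *
      Real.exp (-(∑ n ∈ Finset.range m, a n - ∑ n ∈ Finset.range N, a n)))
      Filter.atTop (nhds (|s N - ε| * 0)) := by
    refine Filter.Tendsto.const_mul _ (Real.tendsto_exp_neg_atTop_nhds_zero.comp ?_)
    exact Filter.tendsto_atTop_add_const_right _ (-∑ n ∈ Finset.range N, a n) ha
  rw [mul_zero] at hlim
  filter_upwards [hlim.eventually (gt_mem_nhds hε), Filter.eventually_ge_atTop N] with n h1 h2
  obtain ⟨k, rfl⟩ := Nat.exists_eq_add_of_le h2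
  linarith [hind k]

end RealInequalities

section EReal

theorem add_coe_le_coe_iff (u : EReal) (r s : ℝ) :
    u + (r : EReal) ≤ (s : EReal) ↔ u ≤ ((s - r : ℝ) : EReal) := by
  induction u using EReal.rec with
  | bot => simp
  | coe a => rw [← EReal.coe_add, EReal.coe_le_coe_iff, EReal.coe_le_coe_iff, le_sub_iff_add_le]
  | top => simp [-EReal.coe_sub]

theorem exists_eq_coe {u : EReal} (h : u ≠ ⊥) (h' : u ≠ ⊤) : ∃ r : ℝ, u = r :=
  ⟨u.toReal, (EReal.coe_toReal h' h).symm⟩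

end EReal

/-! ### Midpoint inequalities, nested sets and minimizers -/

section Geometry

variable {X : Type*} [MetricSpace X] {κ : ℝ}

theorem cos_sqrt_mul_dist_pos (hκ : 0 < κ) (hdist : ∀ w w' : X, dist w w' < Real.pi / √κ / 2)
    (x y : X) : 0 < Real.cos (√κ * dist x y) := by
  have h0 : 0 ≤ √κ * dist x y := by positivity
  exact Real.cos_pos_of_mem_Ioo ⟨by linarith [Real.pi_pos], sqrt_mul_dist_lt hκ hdist x y⟩

theorem continuous_cos_sqrt_mul_dist (p : X) :
    Continuous fun x => Real.cos (√κ * dist x p) := by fun_prop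

theorem IsConvexCombination.eq_left_of_dist_eq_zero {a : ℝ} {x y z : X}
    (h : IsConvexCombination a x y z) (hd : dist x y = 0) : z = x := by
  obtain ⟨c, hc, rfl⟩ := h
  rw [hd, mul_zero, hc.1]

theorem IsConvexCombination.cos_dist_add_le (hκ : 0 < κ) (hX : IsCAT κ X)
    (hdist : ∀ w w' : X, dist w w' < Real.pi / √κ / 2)
    {x y z : X} (h : IsConvexCombination (1 / 2) x y z) (p : X) :
    Real.cos (√κ * dist x p) + Real.cos (√κ * dist y p) ≤
      2 * Real.cos (√κ * dist x y / 2) * Real.cos (√κ * dist z p) := by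
  have hlt := sqrt_mul_dist_lt hκ hdist x y
  have h0 : 0 ≤ √κ * dist x y := by positivity
  rcases h0.eq_or_lt with h1 | h1
  · have hd : dist x y = 0 := by
      rcases mul_eq_zero.mp h1.symm with h | h
      · exact absurd h (Real.sqrt_pos.mpr hκ).ne'
      · exact h
    rw [h.eq_left_of_dist_eq_zero hd, ← dist_eq_zero.mp hd]
    simp
    linarith
  · have key := h.cos_dist_mul_sin_ge hκ hX hdist (by norm_num) (by norm_num) p
    have e1 : 1 / 2 * (√κ * dist x y) = √κ * dist x y / 2 := by ring
    have e2 : (1 - 1 / 2) * (√κ * dist x y) = √κ * dist x y / 2 := by ring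
    have e3 := Real.sin_two_mul (√κ * dist x y / 2)
    rw [mul_div_cancel₀ _ two_ne_zero] at e3
    rw [e1, e2, e3] at key
    have hs : 0 < Real.sin (√κ * dist x y / 2) :=
      Real.sin_pos_of_pos_of_lt_pi (by linarith) (by linarith)
    refine le_of_mul_le_mul_right ?_ hs
    linarith

/-- Balls are convex: by concavity of sine, the two weights sin(aD)/sin D and sin((1 - a)D)/sin D
sum to at least 1. -/
theorem IsConvexCombination.min_cos_dist_le (hκ : 0 < κ) (hX : IsCAT κ X)
    (hdist : ∀ w w' : X, dist w w' < Real.pi / √κ / 2) {a : ℝ} (ha : 0 ≤ a) (ha' : a ≤ 1)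
    {x y z : X} (h : IsConvexCombination a x y z) (p : X) :
    min (Real.cos (√κ * dist x p)) (Real.cos (√κ * dist y p)) ≤ Real.cos (√κ * dist z p) := by
  have hlt := sqrt_mul_dist_lt hκ hdist x y
  have hpi := Real.pi_pos
  have h0 : 0 ≤ √κ * dist x y := by positivity
  rcases h0.eq_or_lt with h1 | h1
  · have hd : dist x y = 0 := by
      rcases mul_eq_zero.mp h1.symm with h | h
      · exact absurd h (Real.sqrt_pos.mpr hκ).ne'
      · exact h
    rw [h.eq_left_of_dist_eq_zero hd]
    exact min_le_left _ _
  · have key := h.cos_dist_mul_sin_ge hκ hX hdist ha ha' p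
    set m := min (Real.cos (√κ * dist x p)) (Real.cos (√κ * dist y p))
    have hm1 : m ≤ Real.cos (√κ * dist x p) := min_le_left _ _
    have hm2 : m ≤ Real.cos (√κ * dist y p) := min_le_right _ _
    have hm : 0 ≤ m := le_min (cos_sqrt_mul_dist_pos hκ hdist x p).le
      (cos_sqrt_mul_dist_pos hκ hdist y p).le
    have hs : 0 < Real.sin (√κ * dist x y) := Real.sin_pos_of_pos_of_lt_pi h1 (by linarith)
    have s1 := mul_sin_le_sin_mul ha ha' h0 (by linarith)
    have s2 := mul_sin_le_sin_mul (sub_nonneg.mpr ha') (by linarith) h0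
      (by linarith : √κ * dist x y ≤ Real.pi)
    refine le_of_mul_le_mul_right ?_ hs
    have t1 := mul_le_mul hm1 s1 (mul_nonneg ha hs.le) (hm.trans hm1)
    have t2 := mul_le_mul hm2 s2 (mul_nonneg (sub_nonneg.mpr ha') hs.le) (hm.trans hm2)
    linarith

variable [CompleteSpace X]

/-- Cantor's intersection theorem, with diameters measured by the quantity 1 - cos(√κ d/2) that
midpoint inequalities control. -/
theorem exists_mem_of_antitone (hκ : 0 < κ) (hdist : ∀ w w' : X, dist w w' < Real.pi / √κ / 2)
    {T : ℕ → Set X} (hT : Antitone T) (hclosed : ∀ k, IsClosed (T k)) (hne : ∀ k, (T k).Nonempty)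
    (hdiam : ∀ e : ℝ, 0 < e → ∃ k, ∀ a ∈ T k, ∀ b ∈ T k,
      1 - Real.cos (√κ * dist a b / 2) ≤ e) :
    ∃ w, ∀ k, w ∈ T k := by
  choose x hx using hne
  have hpi := Real.pi_pos
  have hcauchy : CauchySeq x := by
    refine Metric.cauchySeq_iff'.mpr fun r hr => ?_
    -- Since 1 - cos(√κ d/2) ≥ κd²/(2π²), this tolerance forces d² ≤ r²/2.
    obtain ⟨k, hk⟩ := hdiam (κ * r ^ 2 / (4 * Real.pi ^ 2)) (by positivity)
    refine ⟨k, fun n hn => ?_⟩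
    have h1 := hk _ (hT hn (hx n)) _ (hx k)
    have h2 := two_div_pi_sq_mul_sq_le_one_sub_cos (x := √κ * dist (x n) (x k) / 2)
      (by positivity) (by linarith [sqrt_mul_dist_lt hκ hdist (x n) (x k)])
    have h3 : 2 / Real.pi ^ 2 * (√κ * dist (x n) (x k) / 2) ^ 2 =
        κ / (2 * Real.pi ^ 2) * dist (x n) (x k) ^ 2 := by
      rw [div_pow, mul_pow, Real.sq_sqrt hκ.le]; field_simp
    have h4 : κ * r ^ 2 / (4 * Real.pi ^ 2) = κ / (2 * Real.pi ^ 2) * (r ^ 2 / 2) := by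
      field_simp; norm_num
    rw [h3] at h2
    rw [h4] at h1
    have h5 := le_of_mul_le_mul_left (h2.trans h1) (by positivity)
    refine lt_of_pow_lt_pow_left₀ 2 hr.le ?_
    have : 0 < r ^ 2 := by positivity
    linarith
  obtain ⟨w, hw⟩ := cauchySeq_tendsto_of_complete hcauchy
  refine ⟨w, fun k => (hclosed k).mem_of_tendsto hw ?_⟩
  filter_upwards [Filter.eventually_ge_atTop k] with n hn
  exact hT hn (hx n)

/-- A lower semicontinuous function that is bounded below and uniformly convex at midpoints has a
unique minimizer. -/
theorem existsUnique_mem_argmin (hκ : 0 < κ) (hX : IsCAT κ X)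
    (hdist : ∀ w w' : X, dist w w' < Real.pi / √κ / 2) {g : X → EReal}
    (hlsc : LowerSemicontinuous g) {B : ℝ} (hB : ∀ y, (B : EReal) ≤ g y) (hp : ∃ y, g y ≠ ⊤)
    {c : ℝ} (hc : 0 < c)
    (hmid : ∀ (y₁ y₂ m : X) (a : ℝ), IsConvexCombination (1 / 2) y₁ y₂ m → g y₁ ≤ a → g y₂ ≤ a →
      g m ≤ ((a - c * (1 - Real.cos (√κ * dist y₁ y₂ / 2)) : ℝ) : EReal)) :
    ∃! z, z ∈ argmin g := by
  have hbot : ∀ y, g y ≠ ⊥ := fun y h => by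
    have := hB y
    rw [h] at this
    exact absurd this (by simp)
  set A : Set ℝ := {a | ∃ y, g y ≤ a} with hA
  have hAne : A.Nonempty := by
    obtain ⟨y, hy⟩ := hp
    obtain ⟨r, hr⟩ := exists_eq_coe (hbot y) hy
    exact ⟨r, y, hr.le⟩
  have hAb : BddBelow A := ⟨B, fun a ⟨y, hy⟩ => EReal.coe_le_coe_iff.mp ((hB y).trans hy)⟩
  set I := sInf A
  have hI : ∀ y, (I : EReal) ≤ g y := by
    intro y
    by_contra! h
    obtain ⟨r, h1, h2⟩ := EReal.lt_iff_exists_real_btwn.mp h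
    exact absurd (csInf_le hAb (⟨y, h1.le⟩ : r ∈ A)) (not_le.mpr (EReal.coe_lt_coe_iff.mp h2))
  have hgap : ∀ (e : ℝ) (a b : X), g a ≤ ((I + e : ℝ) : EReal) → g b ≤ ((I + e : ℝ) : EReal) →
      c * (1 - Real.cos (√κ * dist a b / 2)) ≤ e := by
    intro e a b ha hb
    obtain ⟨m, hm⟩ := exists_isConvexCombination hκ hX hdist (1 / 2) a b
    have := EReal.coe_le_coe_iff.mp ((hI m).trans (hmid a b m _ hm ha hb))
    linarith
  obtain ⟨w, hw⟩ := exists_mem_of_antitone (T := fun k : ℕ =>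
      g ⁻¹' Set.Iic ((I + 1 / ((k : ℝ) + 1) : ℝ) : EReal)) hκ hdist
    (by
      intro k l hkl y hy
      refine le_trans (Set.mem_Iic.mp hy) (EReal.coe_le_coe_iff.mpr ?_)
      have := Nat.one_div_le_one_div (α := ℝ) hkl
      linarith)
    (fun k => hlsc.isClosed_preimage _)
    (by
      intro k
      obtain ⟨a, ⟨y, hy⟩, h⟩ := exists_lt_of_csInf_lt hAne
        (lt_add_of_pos_right I (Nat.one_div_pos_of_nat (n := k) (α := ℝ)))
      exact ⟨y, hy.trans (EReal.coe_le_coe_iff.mpr h.le)⟩)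
    (by
      intro e he
      obtain ⟨k, hk⟩ := exists_nat_one_div_lt (mul_pos hc he)
      refine ⟨k, fun a ha b hb => ?_⟩
      exact le_of_mul_le_mul_left ((hgap _ a b ha hb).trans hk.le) hc)
  have hwI : g w ≤ (I : EReal) := by
    refine EReal.le_of_forall_lt_iff_le.mp fun r hr => ?_
    obtain ⟨k, hk⟩ := exists_nat_one_div_lt (sub_pos.mpr (EReal.coe_lt_coe_iff.mp hr))
    exact le_trans (hw k) (EReal.coe_le_coe_iff.mpr (by linarith))
  refine ⟨w, fun y => hwI.trans (hI y), fun z hz => ?_⟩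
  have hzI : g z ≤ (I : EReal) := (hz w).trans hwI
  by_contra hne
  have h := hgap 0 z w (by simpa using hzI) (by simpa using hwI)
  have hpos : 0 < √κ * dist z w := mul_pos (Real.sqrt_pos.mpr hκ) (dist_pos.mpr hne)
  have h2 := two_div_pi_sq_mul_sq_le_one_sub_cos (x := √κ * dist z w / 2)
    (by positivity) (by linarith [sqrt_mul_dist_lt hκ hdist z w, Real.pi_pos])
  have h3 : 0 < 2 / Real.pi ^ 2 * (√κ * dist z w / 2) ^ 2 := by positivity
  have h4 := mul_pos hc (h3.trans_le h2)
  linarith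

end Geometry

/-! ### Convex functions and existence of the resolvent -/

section Convex

variable {X : Type*} [MetricSpace X] {κ : ℝ} {f : X → EReal}

theorem IsProperLscConvex.le_coe (hf : IsProperLscConvex f) {x y z : X} {a s t : ℝ}
    (ha : 0 < a) (ha' : a < 1) (h : IsConvexCombination a x y z) (hx : f x ≤ s) (hy : f y ≤ t) :
    f z ≤ ((a * s + (1 - a) * t : ℝ) : EReal) := by
  refine (hf.convex x y z a ha ha' h).trans ?_
  rw [EReal.coe_add, EReal.coe_mul, EReal.coe_mul]
  exact add_le_add (mul_le_mul_of_nonneg_left hx (EReal.coe_nonneg.mpr ha.le))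
    (mul_le_mul_of_nonneg_left hy (EReal.coe_nonneg.mpr (sub_nonneg.mpr ha'.le)))

/-- Lower semicontinuity bounds `f` below near a point `p`. As the space is bounded, a fixed
fraction δ of any geodesic from `p` stays in that ball, so a very small value at the far end would,
by convexity, contradict the local bound. -/
theorem IsProperLscConvex.exists_lower_bound (hκ : 0 < κ) (hX : IsCAT κ X)
    (hdist : ∀ w w' : X, dist w w' < Real.pi / √κ / 2) (hf : IsProperLscConvex f) :
    ∃ B : ℝ, ∀ y, (B : EReal) ≤ f y := by
  obtain ⟨p, hp⟩ := hf.proper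
  obtain ⟨r, hr⟩ := exists_eq_coe (hf.ne_bot p) hp
  have hlt : ((r - 1 : ℝ) : EReal) < f p := by
    rw [hr]; exact EReal.coe_lt_coe_iff.mpr (by linarith)
  obtain ⟨ρ, hρ, hball⟩ := Metric.eventually_nhds_iff.mp (hf.lsc p _ hlt)
  have hDm : 0 < Real.pi / √κ / 2 := by
    have := Real.sqrt_pos.mpr hκ
    have := Real.pi_pos
    positivity
  set Dm := Real.pi / √κ / 2
  set δ := ρ / (ρ + Dm) with hδ
  have hδ0 : 0 < δ := by positivity
  have hδ1 : δ < 1 := by rw [hδ, div_lt_one (by positivity)]; linarith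
  have hδρ : δ * Dm < ρ := by
    rw [hδ, div_mul_eq_mul_div, div_lt_iff₀ (by positivity)]; nlinarith
  refine ⟨r - 1 / δ, fun y => ?_⟩
  by_contra! hy
  obtain ⟨w, hw⟩ := exists_isConvexCombination hκ hX hdist (1 - δ) p y
  have h1 := hf.le_coe (by linarith) (by linarith) hw hr.le hy.le
  have hwd : dist w p < ρ := by
    rw [dist_comm, hw.dist_left (by linarith) (by linarith)]
    have := mul_lt_mul_of_pos_left (hdist p y) hδ0
    linarith
  have h2 := EReal.coe_lt_coe_iff.mp ((hball hwd).trans_le h1)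
  have h3 : δ * (1 / δ) = 1 := by field_simp
  nlinarith

theorem tan_mul_sin_sqrt_mul_dist (hκ : 0 < κ)
    (hdist : ∀ w w' : X, dist w w' < Real.pi / √κ / 2) (x y : X) :
    Real.tan (√κ * dist y x) * Real.sin (√κ * dist y x) =
      1 / Real.cos (√κ * dist y x) - Real.cos (√κ * dist y x) := by
  have h := cos_sqrt_mul_dist_pos hκ hdist y x
  have h2 := Real.sin_sq_add_cos_sq (√κ * dist y x)
  rw [Real.tan_eq_sin_div_cos]
  field_simp
  linarith

theorem one_div_cos_sub_cos_nonneg (hκ : 0 < κ)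
    (hdist : ∀ w w' : X, dist w w' < Real.pi / √κ / 2) (x y : X) :
    0 ≤ 1 / Real.cos (√κ * dist y x) - Real.cos (√κ * dist y x) := by
  have h := cos_sqrt_mul_dist_pos hκ hdist y x
  have h1 := Real.cos_le_one (√κ * dist y x)
  have := (one_le_div h).mpr h1
  linarith

theorem resolventObjective_le_coe_iff (hκ : 0 < κ)
    (hdist : ∀ w w' : X, dist w w' < Real.pi / √κ / 2) (η : ℝ) (x y : X) (a : ℝ) :
    resolventObjective κ η f x y ≤ (a : EReal) ↔ f y ≤ ((a - 1 / η *
      (1 / Real.cos (√κ * dist y x) - Real.cos (√κ * dist y x)) : ℝ) : EReal) := by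
  rw [resolventObjective, add_coe_le_coe_iff, tan_mul_sin_sqrt_mul_dist hκ hdist]

/-- The resolvent is well defined. -/
theorem IsProperLscConvex.existsUnique_resolvent [CompleteSpace X] (hκ : 0 < κ) (hX : IsCAT κ X)
    (hdist : ∀ w w' : X, dist w w' < Real.pi / √κ / 2) (hf : IsProperLscConvex f) {η : ℝ}
    (hη : 0 < η) (x : X) : ∃! z, z ∈ argmin (resolventObjective κ η f x) := by
  obtain ⟨B, hB⟩ := hf.exists_lower_bound hκ hX hdist
  have hη' : 0 < 1 / η := by positivity
  refine existsUnique_mem_argmin hκ hX hdist (B := B) (c := 1 / η * 2) ?_ ?_ ?_ (by positivity) ?_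
  · have hc : Continuous fun y => ((1 / η *
        (Real.tan (√κ * dist y x) * Real.sin (√κ * dist y x)) : ℝ) : EReal) := by
      refine continuous_coe_real_ereal.comp ?_
      simp only [tan_mul_sin_sqrt_mul_dist hκ hdist]
      have h1 := continuous_cos_sqrt_mul_dist (κ := κ) x
      exact continuous_const.mul ((continuous_const.div h1
        fun y => (cos_sqrt_mul_dist_pos hκ hdist y x).ne').sub h1)
    exact hf.lsc.add' hc.lowerSemicontinuous fun y =>
      EReal.continuousAt_add (Or.inr (EReal.coe_ne_bot _)) (Or.inr (EReal.coe_ne_top _))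
  · intro y
    refine (hB y).trans ?_
    have h := one_div_cos_sub_cos_nonneg hκ hdist x y
    rw [resolventObjective, tan_mul_sin_sqrt_mul_dist hκ hdist]
    exact le_add_of_nonneg_right (EReal.coe_nonneg.mpr (by positivity))
  · obtain ⟨p, hp⟩ := hf.proper
    obtain ⟨r, hr⟩ := exists_eq_coe (hf.ne_bot p) hp
    refine ⟨p, ?_⟩
    rw [resolventObjective, hr, ← EReal.coe_add]
    exact EReal.coe_ne_top _
  · intro y₁ y₂ m a hm h1 h2
    rw [resolventObjective_le_coe_iff hκ hdist] at h1 h2 ⊢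
    refine (hf.le_coe (by norm_num) (by norm_num) hm h1 h2).trans (EReal.coe_le_coe_iff.mpr ?_)
    have hpos := cos_sqrt_mul_dist_pos hκ hdist
    have hk : 0 < Real.cos (√κ * dist y₁ y₂ / 2) := by
      have h0 : 0 ≤ √κ * dist y₁ y₂ := by positivity
      exact Real.cos_pos_of_mem_Ioo ⟨by linarith [Real.pi_pos],
        by linarith [sqrt_mul_dist_lt hκ hdist y₁ y₂]⟩
    have key := one_div_sub_le_of_add_le (hpos y₁ x) (hpos y₂ x) (hpos m x) hk
      (Real.cos_le_one _) (hm.cos_dist_add_le hκ hX hdist x)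
    have := mul_le_mul_of_nonneg_left key hη'.le
    linarith

theorem IsProperLscConvex.resolvent_mem_argmin [CompleteSpace X] (hκ : 0 < κ) (hX : IsCAT κ X)
    (hdist : ∀ w w' : X, dist w w' < Real.pi / √κ / 2) (hf : IsProperLscConvex f) {η : ℝ}
    (hη : 0 < η) (x : X) : resolvent κ η f x ∈ argmin (resolventObjective κ η f x) := by
  have h : (argmin (resolventObjective κ η f x)).Nonempty :=
    (hf.existsUnique_resolvent hκ hX hdist hη x).exists
  rw [resolvent, dif_pos h]
  exact h.choose_spec

theorem IsProperLscConvex.ne_top_of_mem_argmin (hf : IsProperLscConvex f) {u : X}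
    (hu : u ∈ argmin f) : f u ≠ ⊤ := by
  obtain ⟨p, hp⟩ := hf.proper
  exact fun h => hp (top_le_iff.mp (h ▸ hu p))

end Convex

/-! ### Optimality of the resolvent, projection onto the minimizers -/

section Resolvent

variable {X : Type*} [MetricSpace X] {κ : ℝ} {f : X → EReal}

/-- First order optimality for the resolvent. -/
theorem IsProperLscConvex.mul_sin_le_of_mem_argmin (hκ : 0 < κ) (hX : IsCAT κ X)
    (hdist : ∀ w w' : X, dist w w' < Real.pi / √κ / 2) (hf : IsProperLscConvex f) {η : ℝ}
    (hη : 0 < η) {x z u : X} (hz : z ∈ argmin (resolventObjective κ η f x)) {s t : ℝ}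
    (hs : f z = s) (ht : f u = t) (hzu : 0 < √κ * dist u z) :
    η * (s - t) * Real.sin (√κ * dist u z) ≤ (1 + 1 / Real.cos (√κ * dist z x) ^ 2) *
      (√κ * dist u z) * (Real.cos (√κ * dist z x) * Real.cos (√κ * dist u z) -
        Real.cos (√κ * dist u x)) := by
  have hpos := cos_sqrt_mul_dist_pos hκ hdist
  set D := √κ * dist u z with hD
  set c := Real.cos (√κ * dist z x) with hc
  set c' := Real.cos (√κ * dist u x) with hc'
  have hDlt : D < Real.pi / 2 := sqrt_mul_dist_lt hκ hdist u z
  have hc0 : 0 < c := hpos z x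
  have hc'0 : 0 < c' := hpos u x
  have hsin : 0 < Real.sin D := Real.sin_pos_of_pos_of_lt_pi hzu (by linarith)
  -- The comparison lower bound for cos d(w, x) at the point w = a u ⊕ (1 - a) z, with equality at a
  -- = 0.
  set l : ℝ → ℝ := fun a => (c' * Real.sin (a * D) + c * Real.sin ((1 - a) * D)) / Real.sin D
    with hl
  have hl0 : l 0 = c := by simp [hl, hsin.ne']
  have hld : HasDerivAt l ((c' * (Real.cos (0 * D) * (1 * D)) +
      c * (Real.cos ((1 - 0) * D) * (-1 * D))) / Real.sin D) 0 := by
    have h1 : HasDerivAt (fun a : ℝ => a * D) (1 * D) 0 := (hasDerivAt_id 0).mul_const D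
    have h2 : HasDerivAt (fun a : ℝ => (1 - a) * D) (-1 * D) 0 :=
      ((hasDerivAt_id (0 : ℝ)).const_sub 1).mul_const D
    exact ((h1.sin.const_mul c').add (h2.sin.const_mul c)).div_const _
  set l' := (c' * (Real.cos (0 * D) * (1 * D)) +
      c * (Real.cos ((1 - 0) * D) * (-1 * D))) / Real.sin D with hl'
  have hHd : HasDerivAt (fun a => (l a)⁻¹ - l a - a * (η * (s - t)))
      (-l' / (l 0) ^ 2 - l' - 1 * (η * (s - t))) 0 :=
    ((hld.inv (by rw [hl0]; exact hc0.ne')).sub hld).sub ((hasDerivAt_id (0 : ℝ)).mul_const _)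
  -- Minimality of `z` tested along the geodesic towards `u`: replacing the cosine by `l` only
  -- increases the penalty, so the smooth function is minimal at a = 0.
  have hder := nonneg_of_hasDerivAt_of_le hHd (by
    intro a ha ha'
    obtain ⟨w, hw⟩ := exists_isConvexCombination hκ hX hdist a u z
    have hlw : l a ≤ Real.cos (√κ * dist w x) := by
      rw [hl, div_le_iff₀ hsin]
      exact hw.cos_dist_mul_sin_ge hκ hX hdist ha.le ha'.le x
    have hla : 0 < l a := by
      have e1 : 0 < Real.sin (a * D) :=
        Real.sin_pos_of_pos_of_lt_pi (by positivity) (by nlinarith)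
      have e2 : 0 < Real.sin ((1 - a) * D) :=
        Real.sin_pos_of_pos_of_lt_pi (mul_pos (by linarith) hzu) (by nlinarith)
      exact div_pos (by positivity) hsin
    have h1 := hf.le_coe ha ha' hw ht.le hs.le
    have h2 : resolventObjective κ η f x w ≤ ((a * t + (1 - a) * s + 1 / η *
        (1 / Real.cos (√κ * dist w x) - Real.cos (√κ * dist w x)) : ℝ) : EReal) := by
      rw [resolventObjective_le_coe_iff hκ hdist]
      simpa using h1
    have h3 := (hz w).trans h2
    rw [resolventObjective_le_coe_iff hκ hdist, hs, EReal.coe_le_coe_iff, ← hc] at h3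
    have h4 : 1 / Real.cos (√κ * dist w x) ≤ (l a)⁻¹ := by
      rw [inv_eq_one_div]; exact one_div_le_one_div_of_le hla hlw
    have h5 : η * (1 / η) = 1 := by field_simp
    have h6 := mul_le_mul_of_nonneg_left h3 hη.le
    have h7 : η * (a * t + (1 - a) * s + 1 / η * (1 / Real.cos (√κ * dist w x) -
        Real.cos (√κ * dist w x)) - 1 / η * (1 / c - c)) = η * (a * t + (1 - a) * s) +
        η * (1 / η) * ((1 / Real.cos (√κ * dist w x) -
        Real.cos (√κ * dist w x)) - (1 / c - c)) := by ring
    rw [h7, h5] at h6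
    rw [hl0, inv_eq_one_div]
    linarith)
  rw [hl0] at hder
  have hl's : l' * Real.sin D = D * (c' - c * Real.cos D) := by
    rw [hl', div_mul_cancel₀ _ hsin.ne']; simp; ring
  have h8 : η * (s - t) ≤ -(l' * (1 + 1 / c ^ 2)) := by
    have : -l' / c ^ 2 = -(l' * (1 / c ^ 2)) := by ring
    linarith
  have h9 := mul_le_mul_of_nonneg_right h8 hsin.le
  have h10 : -(l' * (1 + 1 / c ^ 2)) * Real.sin D = -(l' * Real.sin D) * (1 + 1 / c ^ 2) := by ring
  rw [h10, hl's] at h9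
  linarith

/-- The resolvent is strongly quasinonexpansive, with control of the value of the function. -/
theorem IsProperLscConvex.resolvent_estimate (hκ : 0 < κ) (hX : IsCAT κ X)
    (hdist : ∀ w w' : X, dist w w' < Real.pi / √κ / 2) (hf : IsProperLscConvex f) {η : ℝ}
    (hη : 0 < η) {x z u : X} (hz : z ∈ argmin (resolventObjective κ η f x))
    (hu : u ∈ argmin f) {s t : ℝ} (hs : f z = s) (ht : f u = t) :
    Real.cos (√κ * dist x u) ≤ Real.cos (√κ * dist z x) * Real.cos (√κ * dist z u) ∧
      η * (s - t) ≤ Real.pi / 2 * (1 + 1 / Real.cos (√κ * dist z x) ^ 2) *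
        (Real.cos (√κ * dist z x) * Real.cos (√κ * dist z u) - Real.cos (√κ * dist x u)) := by
  rw [dist_comm z u, dist_comm x u]
  have hD0 : 0 ≤ √κ * dist u z := by positivity
  rcases hD0.eq_or_lt with h0 | h0
  · have hd : u = z := by
      rcases mul_eq_zero.mp h0.symm with h | h
      · exact absurd h (Real.sqrt_pos.mpr hκ).ne'
      · exact dist_eq_zero.mp h
    subst hd
    have : s = t := EReal.coe_eq_coe_iff.mp (hs.symm.trans ht)
    simp [this]
  · have key := hf.mul_sin_le_of_mem_argmin hκ hX hdist hη hz hs ht h0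
    have hst : t ≤ s := EReal.coe_le_coe_iff.mp (by rw [← hs, ← ht]; exact hu z)
    have hlt := sqrt_mul_dist_lt hκ hdist u z
    have hpi := Real.pi_pos
    have hc := cos_sqrt_mul_dist_pos hκ hdist z x
    set D := √κ * dist u z
    set c := Real.cos (√κ * dist z x)
    -- Jordan's inequality sin D ≥ 2D/π lets the factor D cancel, giving the constant π/2.
    have hjor := Real.mul_le_sin h0.le hlt.le
    have hst' : 0 ≤ η * (s - t) := mul_nonneg hη.le (sub_nonneg.mpr hst)
    have hsin : 0 ≤ Real.sin D := le_trans (by positivity) hjor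
    have hcoef : 0 < (1 + 1 / c ^ 2) * D := by positivity
    constructor
    · have := nonneg_of_mul_nonneg_right ((mul_nonneg hst' hsin).trans key) hcoef
      linarith
    · have h1 := (mul_le_mul_of_nonneg_left hjor hst').trans key
      have h2 : 0 < 2 / Real.pi * D := by positivity
      refine le_of_mul_le_mul_right (h1.trans (le_of_eq ?_)) h2
      field_simp

/-- The indicator function of a nonempty convex sublevel set, in the sense of convex analysis. -/
theorem isProperLscConvex_indicator_argmin (hf : IsProperLscConvex f)
    (hne : (argmin f).Nonempty) :
    ∃ g : X → EReal, IsProperLscConvex g ∧ (∀ x ∈ argmin f, g x = 0) ∧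
      ∀ x ∉ argmin f, g x = ⊤ := by
  classical
  obtain ⟨u, hu⟩ := hne
  obtain ⟨t, ht⟩ := exists_eq_coe (hf.ne_bot u) (hf.ne_top_of_mem_argmin hu)
  have hmem : ∀ x, x ∈ argmin f ↔ f x ≤ (t : EReal) := fun x =>
    ⟨fun hx => ht ▸ hx u, fun hx y => (hx.trans ht.ge).trans (hu y)⟩
  have hclosed : IsClosed (argmin f) := by
    have : argmin f = f ⁻¹' Set.Iic (t : EReal) := Set.ext hmem
    rw [this]
    exact hf.lsc.isClosed_preimage _
  refine ⟨fun x => if x ∈ argmin f then 0 else ⊤, ⟨?_, ?_, ?_, ?_⟩, fun x hx => if_pos hx,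
    fun x hx => if_neg hx⟩
  · intro x
    split_ifs <;> simp
  · exact ⟨u, by simp [hu]⟩
  · refine lowerSemicontinuous_iff_isClosed_preimage.mpr fun y => ?_
    rcases lt_or_ge y 0 with hy | hy
    · convert isClosed_empty (X := X)
      refine Set.eq_empty_of_forall_notMem fun x hx => ?_
      have hx' : (if x ∈ argmin f then (0 : EReal) else ⊤) ≤ y := hx
      split_ifs at hx'
      · exact absurd (hx'.trans_lt hy) (lt_irrefl _)
      · exact absurd ((le_top (a := (0 : EReal))).trans hx' |>.trans_lt hy) (lt_irrefl _)
    · rcases eq_or_ne y ⊤ with rfl | hy'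
      · convert isClosed_univ (X := X)
        ext x
        simp
      · convert hclosed
        ext x
        change (if x ∈ argmin f then (0 : EReal) else ⊤) ≤ y ↔ _
        split_ifs with h
        · simp [h, hy]
        · simp [h, hy']
  · intro x y z a ha ha' hz
    have ha0 : (0 : EReal) < (a : EReal) := EReal.coe_pos.mpr ha
    have ha1 : (0 : EReal) < ((1 - a : ℝ) : EReal) := EReal.coe_pos.mpr (by linarith)
    by_cases hx : x ∈ argmin f
    · by_cases hy : y ∈ argmin f
      · have : z ∈ argmin f := by
          rw [hmem] at hx hy ⊢
          refine (hf.le_coe ha ha' hz hx hy).trans (EReal.coe_le_coe_iff.mpr (le_of_eq ?_))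
          ring
        simp [hx, hy, this]
      · simp only [if_pos hx, if_neg hy]
        rw [EReal.mul_top_of_pos ha1, mul_zero, zero_add]
        exact le_top
    · simp only [if_neg hx]
      rw [EReal.mul_top_of_pos ha0, EReal.top_add_of_ne_bot]
      · exact le_top
      · split_ifs
        · simp
        · rw [EReal.mul_top_of_pos ha1]; simp

theorem lt_of_cos_sqrt_mul_dist_lt (hκ : 0 < κ)
    (hdist : ∀ w w' : X, dist w w' < Real.pi / √κ / 2) {x y z w : X}
    (h : Real.cos (√κ * dist z w) < Real.cos (√κ * dist x y)) : dist x y < dist z w := by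
  by_contra! hle
  refine absurd h (not_lt.mpr (Real.cos_le_cos_of_nonneg_of_le_pi (by positivity) ?_
    (mul_le_mul_of_nonneg_left hle (Real.sqrt_nonneg _))))
  linarith [sqrt_mul_dist_lt hκ hdist x y, Real.pi_pos]

/-- The metric projection onto the set of minimizers is well defined. -/
theorem IsProperLscConvex.exists_isMetricProjection [CompleteSpace X] (hκ : 0 < κ)
    (hX : IsCAT κ X) (hdist : ∀ w w' : X, dist w w' < Real.pi / √κ / 2)
    (hf : IsProperLscConvex f) (hne : (argmin f).Nonempty) :
    ∃ P : X → X, IsMetricProjection (argmin f) P := by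
  obtain ⟨g, hg, hg0, hg1⟩ := isProperLscConvex_indicator_argmin hf hne
  -- On the set of minimizers the objective is 1/cos - cos of the distance, which increases with
  -- distance, so the resolvent of the indicator is the nearest point.
  choose P hP hPu using hg.existsUnique_resolvent hκ hX hdist one_pos
  have hval : ∀ x, ∀ q ∈ argmin f, resolventObjective κ 1 g x q =
      ((1 / Real.cos (√κ * dist q x) - Real.cos (√κ * dist q x) : ℝ) : EReal) := by
    intro x q hq
    rw [resolventObjective, hg0 q hq, zero_add, tan_mul_sin_sqrt_mul_dist hκ hdist, div_one,
      one_mul]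
  have hPmem : ∀ x, P x ∈ argmin f := by
    intro x
    by_contra h
    obtain ⟨q, hq⟩ := hne
    have := hP x q
    rw [hval x q hq, resolventObjective, hg1 _ h, EReal.top_add_coe] at this
    exact EReal.coe_ne_top _ (top_le_iff.mp this)
  refine ⟨P, fun x => ⟨hPmem x, fun q hq hne' => ?_⟩⟩
  rw [dist_comm x, dist_comm x]
  by_contra! hle
  refine hne' (hPu x q fun y => le_trans ?_ (hP x y))
  rw [hval x q hq, hval x _ (hPmem x), EReal.coe_le_coe_iff]
  have h1 := cos_sqrt_mul_dist_pos hκ hdist (P x) x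
  have h2 : Real.cos (√κ * dist (P x) x) ≤ Real.cos (√κ * dist q x) := by
    refine Real.cos_le_cos_of_nonneg_of_le_pi (by positivity) ?_
      (mul_le_mul_of_nonneg_left hle (Real.sqrt_nonneg _))
    linarith [sqrt_mul_dist_lt hκ hdist (P x) x, Real.pi_pos]
  have h3 := one_div_le_one_div_of_le h1 h2
  linarith

/-- Points at which the function is almost minimal are not much closer to `v` than the
projection of `v` onto the set of minimizers. -/
theorem IsProperLscConvex.exists_forall_cos_lt [CompleteSpace X] (hκ : 0 < κ) (hX : IsCAT κ X)
    (hdist : ∀ w w' : X, dist w w' < Real.pi / √κ / 2) (hf : IsProperLscConvex f) {p v : X}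
    (hp : p ∈ argmin f) (hpv : ∀ q ∈ argmin f, dist v p ≤ dist v q) {μ : ℝ} (hμ : f p = μ)
    {δ : ℝ} (hδ : 0 < δ) :
    ∃ e : ℝ, 0 < e ∧ ∀ z, f z ≤ ((μ + e : ℝ) : EReal) →
      Real.cos (√κ * dist z v) < Real.cos (√κ * dist p v) + δ := by
  by_contra! hcon
  set C : X → ℝ := fun z => Real.cos (√κ * dist z v) with hC
  -- Its supremum `M` is the limit, as e decreases to 0, of the supremum of `C` over the sublevel
  -- set at height μ + e. Almost-maximizers of `C` there form shrinking sets, whose common point is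
  -- a minimizer of `f` nearer to `v` than `p`.
  set A : Set ℝ := {a | ∀ e : ℝ, 0 < e → ∃ z, f z ≤ ((μ + e : ℝ) : EReal) ∧ a ≤ C z} with hA
  have hAb : BddAbove A := ⟨1, fun a ha => by
    obtain ⟨z, -, hz⟩ := ha 1 one_pos
    exact hz.trans (Real.cos_le_one _)⟩
  have hmemA : C p + δ ∈ A := hcon
  set M := sSup A
  have hM : C p + δ ≤ M := le_csSup hAb hmemA
  have hCpos : ∀ z, 0 < C z := fun z => cos_sqrt_mul_dist_pos hκ hdist z v
  have hM0 : 0 < M := by linarith [hCpos p]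
  have hbelow : ∀ r : ℝ, 0 < r → M - r ∈ A := by
    intro r hr e he
    obtain ⟨a, ha, hlt⟩ := exists_lt_of_lt_csSup ⟨_, hmemA⟩ (sub_lt_self M hr)
    obtain ⟨z, hz, hz'⟩ := ha e he
    exact ⟨z, hz, hlt.le.trans hz'⟩
  have habove : ∀ r : ℝ, 0 < r → ∃ e : ℝ, 0 < e ∧ ∀ z, f z ≤ ((μ + e : ℝ) : EReal) →
      C z < M + r := by
    intro r hr
    by_contra! h
    have h' : M + r ∈ A := h
    linarith [le_csSup hAb h']
  obtain ⟨w, hw⟩ := exists_mem_of_antitone (T := fun k : ℕ =>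
      f ⁻¹' Set.Iic ((μ + 1 / ((k : ℝ) + 1) : ℝ) : EReal) ∩ C ⁻¹' Set.Ici (M - 1 / ((k : ℝ) + 1)))
      hκ hdist
    (by
      intro k l hkl y hy
      have h1 := Nat.one_div_le_one_div (α := ℝ) hkl
      have h2 : M - 1 / ((l : ℝ) + 1) ≤ C y := hy.2
      have h3 : M - 1 / ((k : ℝ) + 1) ≤ C y := by linarith
      exact ⟨le_trans (Set.mem_Iic.mp hy.1) (EReal.coe_le_coe_iff.mpr (by linarith)), h3⟩)
    (fun k => (hf.lsc.isClosed_preimage _).inter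
      (isClosed_Ici.preimage (continuous_cos_sqrt_mul_dist v)))
    (by
      intro k
      have hk : (0 : ℝ) < 1 / ((k : ℝ) + 1) := Nat.one_div_pos_of_nat
      obtain ⟨z, hz, hz'⟩ := hbelow _ hk _ hk
      exact ⟨z, hz, hz'⟩)
    (by
      intro r hr
      obtain ⟨e, he, hbd⟩ := habove (M * r / 2) (by positivity)
      obtain ⟨k, hk⟩ := exists_nat_one_div_lt (lt_min he (by positivity : 0 < M * r / 2))
      refine ⟨k, fun a ha b hb => ?_⟩
      obtain ⟨m, hm⟩ := exists_isConvexCombination hκ hX hdist (1 / 2) a b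
      have hk1 := hk.trans_le (min_le_left _ _)
      have hk2 := hk.trans_le (min_le_right _ _)
      have h1 := hf.le_coe (by norm_num) (by norm_num) hm ha.1 hb.1
      have h2 := hbd m (h1.trans (EReal.coe_le_coe_iff.mpr (by linarith)))
      have h3 : C a + C b ≤ 2 * Real.cos (√κ * dist a b / 2) * C m :=
        hm.cos_dist_add_le hκ hX hdist v
      have h4 : M - 1 / ((k : ℝ) + 1) ≤ C a := ha.2
      have h5 : M - 1 / ((k : ℝ) + 1) ≤ C b := hb.2
      have h6 : 0 < Real.cos (√κ * dist a b / 2) := by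
        have h0 : 0 ≤ √κ * dist a b := by positivity
        exact Real.cos_pos_of_mem_Ioo ⟨by linarith [Real.pi_pos],
          by linarith [sqrt_mul_dist_lt hκ hdist a b]⟩
      have h7 := Real.cos_le_one (√κ * dist a b / 2)
      set k' := Real.cos (√κ * dist a b / 2)
      have h8 : k' * C m ≤ k' * (M + M * r / 2) := mul_le_mul_of_nonneg_left h2.le h6.le
      have h9 : k' * (M * r / 2) ≤ M * r / 2 := by
        have : 0 ≤ M * r / 2 := by positivity
        nlinarith
      have h10 : M * (1 - k') ≤ M * r := by linarith
      exact le_of_mul_le_mul_left h10 hM0)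
  have hwμ : f w ≤ (μ : EReal) := by
    refine EReal.le_of_forall_lt_iff_le.mp fun r hr => ?_
    obtain ⟨k, hk⟩ := exists_nat_one_div_lt (sub_pos.mpr (EReal.coe_lt_coe_iff.mp hr))
    exact le_trans (hw k).1 (EReal.coe_le_coe_iff.mpr (by linarith))
  have hwarg : w ∈ argmin f := fun y => (hwμ.trans hμ.ge).trans (hp y)
  obtain ⟨k, hk⟩ := exists_nat_one_div_lt hδ
  have h1 : M - 1 / ((k : ℝ) + 1) ≤ C w := (hw k).2
  have h2 : C p < C w := by linarith
  have h3 := lt_of_cos_sqrt_mul_dist_lt hκ hdist h2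
  have h4 := hpv w hwarg
  rw [dist_comm v p, dist_comm v w] at h4
  linarith

end Resolvent

/-! ### Convergence of the algorithm -/

section Convergence

variable {X : Type*} [MetricSpace X] {κ : ℝ}

theorem tendsto_of_one_sub_cos_tendsto_zero (hκ : 0 < κ)
    (hdist : ∀ w w' : X, dist w w' < Real.pi / √κ / 2) {y : ℕ → X} {p : X}
    (h : ∀ ε : ℝ, 0 < ε → ∀ᶠ n in Filter.atTop, 1 - Real.cos (√κ * dist (y n) p) ≤ ε) :
    Filter.Tendsto y Filter.atTop (nhds p) := by
  have hpi := Real.pi_pos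
  refine Metric.tendsto_nhds.mpr fun r hr => ?_
  filter_upwards [h (κ * r ^ 2 / Real.pi ^ 2) (by positivity)] with n hn
  have h2 := two_div_pi_sq_mul_sq_le_one_sub_cos (x := √κ * dist (y n) p)
    (by positivity) (by linarith [sqrt_mul_dist_lt hκ hdist (y n) p])
  rw [mul_pow, Real.sq_sqrt hκ.le] at h2
  have h3 : 2 / Real.pi ^ 2 * (κ * dist (y n) p ^ 2) = κ / Real.pi ^ 2 *
    (2 * dist (y n) p ^ 2) := by ring
  have h4 : κ * r ^ 2 / Real.pi ^ 2 = κ / Real.pi ^ 2 * r ^ 2 := by ring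
  rw [h3] at h2
  rw [h4] at hn
  have h5 := le_of_mul_le_mul_left (h2.trans hn) (by positivity)
  refine lt_of_pow_lt_pow_left₀ 2 hr.le ?_
  have : 0 < r ^ 2 := by positivity
  linarith

/-- Convergence of the Halpern type proximal point algorithm. -/
theorem IsProperLscConvex.eventually_one_sub_cos_le [CompleteSpace X] (hκ : 0 < κ)
    (hX : IsCAT κ X) (hdist : ∀ w w' : X, dist w w' < Real.pi / √κ / 2) {f : X → EReal}
    (hf : IsProperLscConvex f) {v p : X} {α lam : ℕ → ℝ} {y z : ℕ → X}
    (hα : ∀ n, α n ∈ Set.Ioc (0 : ℝ) 1) (hlam : ∀ n, 0 < lam n)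
    (hz : ∀ n, z n ∈ argmin (resolventObjective κ (lam n) f (y n)))
    (hy : ∀ n, IsConvexCombination (α n) v (z n) (y (n + 1)))
    (hα0 : Filter.Tendsto α Filter.atTop (nhds 0))
    (hsum : Filter.Tendsto (fun N => ∑ n ∈ Finset.range N, α n ^ 2) Filter.atTop Filter.atTop)
    {lam₀ : ℝ} (hlam₀ : 0 < lam₀) (hlamge : ∀ n, lam₀ ≤ lam n)
    (hp : p ∈ argmin f) (hpv : ∀ q ∈ argmin f, dist v p ≤ dist v q) {ε : ℝ} (hε : 0 < ε) :
    ∀ᶠ n in Filter.atTop, 1 - Real.cos (√κ * dist (y n) p) ≤ ε ∧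
      1 - Real.cos (√κ * dist (z n) p) ≤ ε := by
  have hpi := Real.pi_pos
  have hpos := cos_sqrt_mul_dist_pos hκ hdist
  obtain ⟨μ, hμ⟩ := exists_eq_coe (hf.ne_bot p) (hf.ne_top_of_mem_argmin hp)
  have hztop : ∀ n, f (z n) ≠ ⊤ := by
    intro n h
    have h1 := hz n p
    rw [resolventObjective, resolventObjective, h, hμ, EReal.top_add_coe, ← EReal.coe_add] at h1
    exact EReal.coe_ne_top _ (top_le_iff.mp h1)
  choose s hs using fun n => exists_eq_coe (hf.ne_bot (z n)) (hztop n)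
  have hest := fun n => hf.resolvent_estimate hκ hX hdist (hlam n) (hz n) hp (hs n) hμ
  set q := Real.cos (√κ * dist v p) with hq
  set c : ℕ → ℝ := fun n => Real.cos (√κ * dist (z n) p) with hc
  set C : ℕ → ℝ := fun n => Real.cos (√κ * dist (y n) p) with hC
  have hq0 : 0 < q := hpos v p
  have hq1 : q ≤ 1 := Real.cos_le_one _
  have hc0 : ∀ n, 0 < c n := fun n => hpos _ _
  have hc1 : ∀ n, c n ≤ 1 := fun n => Real.cos_le_one _
  have hCc : ∀ n, C n ≤ c n := fun n => (hest n).1.trans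
    (mul_le_of_le_one_left (hc0 n).le (Real.cos_le_one _))
  have hCz : ∀ n, C n ≤ Real.cos (√κ * dist (z n) (y n)) := fun n => (hest n).1.trans
    (mul_le_of_le_one_right (hpos _ _).le (hc1 n))
  -- A uniform positive bound keeps the factor 1 + 1/cos² d(z_n, y_n) in the resolvent estimate
  -- bounded by a constant.
  obtain ⟨m, hm0, hm⟩ : ∃ m, 0 < m ∧ ∀ n, m ≤ C n := by
    refine ⟨min q (C 0), lt_min hq0 (hpos _ _), fun n => ?_⟩
    induction n with
    | zero => exact min_le_right _ _
    | succ n ih =>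
      exact (le_min (min_le_left _ _) (ih.trans (hCc n))).trans
        ((hy n).min_cos_dist_le hκ hX hdist (hα n).1.le (hα n).2 p)
  have hstep : ∀ n, ∃ b, α n ^ 2 / 2 ≤ b ∧ b ≤ α n ∧ (1 - b) * c n +
      b * (q * (1 - α n) / (Real.cos (√κ * dist v (z n)) + α n)) ≤ C (n + 1) := by
    intro n
    refine exists_halpern_weight (hα n).1 (hα n).2 (by positivity) (sqrt_mul_dist_lt hκ hdist _ _)
      hq0.le ?_ ((hy n).cos_dist_mul_sin_ge hκ hX hdist (hα n).1.le (hα n).2 p)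
    intro h
    have hd : dist v (z n) = 0 := by
      rcases mul_eq_zero.mp h with h | h
      · exact absurd h (Real.sqrt_pos.mpr hκ).ne'
      · exact h
    have hvz := dist_eq_zero.mp hd
    have hyv := (hy n).eq_left_of_dist_eq_zero hd
    simp only [hC, hc, hq, hyv, ← hvz, and_self]
  choose b hb1 hb2 hb using hstep
  have hb0 : ∀ n, 0 ≤ b n := fun n => le_trans (by positivity) (hb1 n)
  have hbone : ∀ n, b n ≤ 1 := fun n => (hb2 n).trans (hα n).2
  set ε' := ε / 2 with hε'
  have hε'0 : 0 < ε' := by positivity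
  -- Chosen so that (1 - ε')(q + 2δ) ≤ q - δ: one δ for the cosine error and one for `α n` in the
  -- denominator of τ, one for the numerator.
  set δ := ε' * q / 3 with hδ
  have hδ0 : 0 < δ := by positivity
  obtain ⟨e, he0, he⟩ := hf.exists_forall_cos_lt hκ hX hdist hp hpv hμ hδ0
  set K := Real.pi / 2 * (1 + 1 / m ^ 2) with hK
  have hK0 : 0 < K := by positivity
  set θ := lam₀ * e / K with hθ
  have hθ0 : 0 < θ := by positivity
  have hsumh : Filter.Tendsto (fun N => ∑ n ∈ Finset.range N, α n ^ 2 / 2)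
      Filter.atTop Filter.atTop := by
    simp only [← Finset.sum_div]
    exact hsum.atTop_div_const two_pos
  -- The bounds 1/2 and θ/2 give b ≤ (1 - b)θ in the case of a large value of `f`; the bound δ
  -- serves the other case.
  have hsmall : ∀ᶠ n in Filter.atTop, α n < min (1 / 2) (min (θ / 2) δ) :=
    hα0.eventually (gt_mem_nhds (by positivity))
  have hrec : ∀ᶠ n in Filter.atTop, 1 - C (n + 1) ≤ (1 - b n) * (1 - C n) + b n * ε' := by
    filter_upwards [hsmall] with n hn
    obtain ⟨hn1, hn2⟩ := lt_min_iff.mp hn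
    obtain ⟨hn4, hn5⟩ := lt_min_iff.mp hn2
    have hα' := (hα n).1
    have hb' := hb n
    have hDpos := hpos v (z n)
    set τ := q * (1 - α n) / (Real.cos (√κ * dist v (z n)) + α n) with hτ
    -- Almost minimal value: τ ≥ 1 - ε'. Otherwise c - C ≥ θ, and the term with τ is simply dropped.
    rcases le_or_gt (s n) (μ + e) with hcase | hcase
    · have h1 := he (z n) (by rw [hs n]; exact EReal.coe_le_coe_iff.mpr hcase)
      rw [dist_comm (z n) v, dist_comm p v] at h1
      have h2 : 1 - ε' ≤ τ := by
        rw [hτ, le_div_iff₀ (by linarith)]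
        rcases le_or_gt (1 - ε') 0 with h3 | h3
        · have : 0 ≤ q * (1 - α n) := mul_nonneg hq0.le (by linarith)
          exact (mul_nonpos_of_nonpos_of_nonneg h3 (by linarith)).trans this
        · have h4 : (1 - ε') * (Real.cos (√κ * dist v (z n)) + α n) ≤ (1 - ε') * (q + 2 * δ) :=
            mul_le_mul_of_nonneg_left (by linarith) h3.le
          have h5 : q * α n ≤ δ := (mul_le_of_le_one_left hα'.le hq1).trans hn5.le
          have h6 : ε' * q = 3 * δ := by rw [hδ]; ring
          linarith [mul_pos hε'0 hδ0]
      have h3 := mul_le_mul_of_nonneg_left h2 (hb0 n)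
      have h4 := mul_le_mul_of_nonneg_left (hCc n) (sub_nonneg.mpr (hbone n))
      linarith
    · have h1 := (hest n).2
      have hzy := hCz n
      have hzy0 : 0 < Real.cos (√κ * dist (z n) (y n)) := hpos _ _
      have hzy1 : Real.cos (√κ * dist (z n) (y n)) ≤ 1 := Real.cos_le_one _
      have h2 : Real.pi / 2 * (1 + 1 / Real.cos (√κ * dist (z n) (y n)) ^ 2) ≤ K := by
        have : 1 / Real.cos (√κ * dist (z n) (y n)) ^ 2 ≤ 1 / m ^ 2 :=
          one_div_le_one_div_of_le (by positivity)
            (pow_le_pow_left₀ hm0.le ((hm n).trans hzy) 2)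
        exact mul_le_mul_of_nonneg_left (by linarith) (by positivity)
      have h3 : Real.cos (√κ * dist (z n) (y n)) * c n - C n ≤ c n - C n := by
        have := mul_le_of_le_one_left (hc0 n).le hzy1
        linarith
      have h4 : lam₀ * e ≤ K * (c n - C n) := by
        have e1 : lam₀ * e ≤ lam n * (s n - μ) :=
          mul_le_mul (hlamge n) (by linarith) he0.le (hlam n).le
        exact e1.trans (h1.trans (mul_le_mul h2 h3 (sub_nonneg.mpr (hest n).1) hK0.le))
      have h5 : θ ≤ c n - C n := by
        rw [hθ, div_le_iff₀ hK0]; linarith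
      have hτ0 : 0 ≤ τ := div_nonneg (mul_nonneg hq0.le (by linarith)) (by linarith)
      have h6 := mul_nonneg (hb0 n) hτ0
      have h7 := mul_nonneg (hb0 n) hε'0.le
      have h8 : (1 - b n) * θ ≤ (1 - b n) * (c n - C n) :=
        mul_le_mul_of_nonneg_left h5 (sub_nonneg.mpr (hbone n))
      have h9 : b n ≤ (1 - b n) * θ := by
        have : 1 / 2 * θ ≤ (1 - b n) * θ :=
          mul_le_mul_of_nonneg_right (by linarith [hb2 n]) hθ0.le
        linarith [hb2 n]
      linarith
  filter_upwards [eventually_le_of_le_mul_add (s := fun n => 1 - C n) hε'0 hbone hb1 hsumh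
    hrec] with n hn
  have h1 : 1 - C n ≤ ε := by linarith
  exact ⟨h1, by linarith [hCc n]⟩

end Convergence

end CATSpace

theorem corollary6p3 {X : Type*} [MetricSpace X] [CompleteSpace X]
    (κ : ℝ) (hκ : 0 < κ) (hX : CATSpace.IsCAT κ X)
    (hdist : ∀ w w' : X, dist w w' < Real.pi / √κ / 2)
    (f : X → EReal) (hf : CATSpace.IsProperLscConvex f) :
    (∀ η : ℝ, 0 < η → ∀ x : X,
      ∃! z, z ∈ CATSpace.argmin (CATSpace.resolventObjective κ η f x)) ∧
    ∀ (v : X) (α lam : ℕ → ℝ) (y : ℕ → X),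
      (∀ n, α n ∈ Set.Ioc (0 : ℝ) 1) →
      (∀ n, 0 < lam n) →
      (∀ n, CATSpace.IsConvexCombination (α n) v
        (CATSpace.resolvent κ (lam n) f (y n)) (y (n + 1))) →
      Filter.Tendsto α Filter.atTop (nhds 0) →
      Filter.Tendsto (fun N => ∑ n ∈ Finset.range N, α n ^ 2) Filter.atTop Filter.atTop →
      0 < ⨅ n, lam n →
      (CATSpace.argmin f).Nonempty →
      ∃ P : X → X, CATSpace.IsMetricProjection (CATSpace.argmin f) P ∧
        Filter.Tendsto y Filter.atTop (nhds (P v)) ∧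
        Filter.Tendsto (fun n => CATSpace.resolvent κ (lam n) f (y n))
          Filter.atTop (nhds (P v)) := by
  refine ⟨fun η hη x => hf.existsUnique_resolvent hκ hX hdist hη x, ?_⟩
  intro v α lam y hα hlam hy hα0 hsum hinf hne
  obtain ⟨P, hP⟩ := hf.exists_isMetricProjection hκ hX hdist hne
  have hpv : ∀ q ∈ CATSpace.argmin f, dist v (P v) ≤ dist v q := by
    intro q hq
    rcases eq_or_ne q (P v) with rfl | h
    · exact le_rfl
    · exact ((hP v).2 q hq h).le
  have hlamge : ∀ n, ⨅ n, lam n ≤ lam n :=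
    fun n => ciInf_le ⟨0, by rintro _ ⟨k, rfl⟩; exact (hlam k).le⟩ n
  have key := fun (ε : ℝ) (hε : 0 < ε) => hf.eventually_one_sub_cos_le hκ hX hdist hα hlam
    (fun n => hf.resolvent_mem_argmin hκ hX hdist (hlam n) (y n)) hy hα0 hsum hinf hlamge
    (hP v).1 hpv hε
  exact ⟨P, hP,
    CATSpace.tendsto_of_one_sub_cos_tendsto_zero hκ hdist
      fun ε hε => (key ε hε).mono fun n h => h.1,
    CATSpace.tendsto_of_one_sub_cos_tendsto_zero hκ hdist
      fun ε hε => (key ε hε).mono fun n h => h.2⟩
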